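/- **Setting.** Let $\Omega\subset\mathbb R^3$ be a bounded polyhedral open set, equal to the interior of its closure (for instance, a polyhedral domain with Lipschitz boundary), let $\mathcal T_h$ be a regular (conforming) tetrahedral mesh of $\Omega$ with vertex set $\mathcal N_h$, and let $\kappa\ge 1$, $h>0$ be such that $\mathcal T_h$ is $\kappa$-quasi-uniform with mesh size $h$: every $K\in\mathcal T_h$ contains a ball of diameter at least $\operatorname{diam}(K)/\kappa$, and $\kappa^{-1}h\le\operatorname{diam}(K)\le h$. Let $\mathcal S^1(\mathcal T_h)$ be the space of continuous functions on $\overline\Omega$ that are affine on each $K\in\mathcal T_h$, with nodal basis $(\varphi_z)_{z\in\mathcal N_h}$, and assume the angle condition $(\nabla\varphi_z,\nabla\varphi_{z'})\le 0$ for all $z\ne z'$ in $\mathcal N_h$, where $(\cdot,\cdot)$ and $\|\cdot\|$ are the scalar product and the norm of $L^2(\Omega)$. Put $$\mathcal M_h=\{\phi\in\mathcal S^1(\mathcal T_h)^3:|\phi(z)|=1\ \forall z\in\mathcal N_h\},\qquad \mathcal K_h(\psi)=\{\phi\in\mathcal S^1(\mathcal T_h)^3:\psi(z)\cdot\phi(z)=0\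 \forall z\in\mathcal N_h\}.$$ Let $\alpha,\ell_{ex},\ell_{dm}>0$, and let $$\mathcal E(m)=\tfrac{\ell_{ex}^2}{2}\|\nabla m\|^2+\tfrac{\ell_{dm}}{2}(\operatorname{curl}m,m).$$ For a time-step size $k>0$, $k\neq1$, let $\rho(k)=|k\log k|$, $M(k)=|k\log k|^{-1}$ and, for $M>0$, $W_M(s)=\alpha+\tfrac k2\min\{s,M\}$ if $s\ge0$, $W_M(s)=2\alpha^2/(2\alpha+k\min\{-s,M\})$ if $s<0$. **TPS2 iterates.** Let $N\ge1$. Functions $m_h^0,\dots,m_h^N\in\mathcal M_h$ and $v_h^0,\dots,v_h^{N-1}$ are iterates of TPS2 if, for all $0\le i\le N-1$, with $\lambda_h^i=-\ell_{ex}^2|\nabla m_h^i|^2-\ell_{dm}(\operatorname{curl}m_h^i)\cdot m_h^i$, one has $v_h^i\in\mathcal K_h(m_h^i)$, $$\begin{aligned}&(W_{M(k)}(\lambda_h^i)v_h^i,\phi)+(m_h^i\times v_h^i,\phi)+\tfrac{\ell_{ex}^2}{2}k[1+\rho(k)](\nabla v_h^i,\nabla\phi)+\tfrac{\ell_{dm}}4k(v_h^i,\operatorname{curl}\phi)+\tfrac{\ell_{dm}}4k(\operatorname{curl}v_h^i,\phi)\\&\qquad=-\ell_{ex}^2(\nabla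 m_h^i,\nabla\phi)-\tfrac{\ell_{dm}}2(\operatorname{curl}m_h^i,\phi)-\tfrac{\ell_{dm}}2(m_h^i,\operatorname{curl}\phi)\qquad\text{for all }\phi\in\mathcal K_h(m_h^i),\end{aligned}$$ and $m_h^{i+1}(z)=\dfrac{m_h^i(z)+kv_h^i(z)}{|m_h^i(z)+kv_h^i(z)|}$ for all $z\in\mathcal N_h$. **Proposition (discrete energy law and stability of TPS2).** There is a constant $C>0$, depending only on $\kappa$ and $\ell_{dm}$, such that all iterates of TPS2 satisfy, for every $1\le j\le N$, $$\mathcal E(m_h^j)+k\sum_{i=0}^{j-1}(W_{M(k)}(\lambda_h^i)v_h^i,v_h^i)+\tfrac{\ell_{ex}^2}{2}\rho(k)k^2\sum_{i=0}^{j-1}\|\nabla v_h^i\|^2\le\mathcal E(m_h^0)+Ch^{-1}k^2\sum_{i=0}^{j-1}\|v_h^i\|^2 .$$ Moreover, there are a threshold $k_0>0$, depending only on $\alpha,\ell_{ex},\ell_{dm}$, and a constant $C'>0$, depending only on $\alpha,\kappa,\ell_{dm}$, such that, whenever $C_0>0$, $\|m_h^0\|_{H^1(\Omega)}\le C_0$,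 $k\le k_0$ and $k\le C'h$, for every $1\le j\le N$, $$\|m_h^j\|_{H^1(\Omega)}^2+k\sum_{i=0}^{j-1}\|v_h^i\|^2+\rho(k)k^2\sum_{i=0}^{j-1}\|\nabla v_h^i\|^2\le C'',$$ where $C''>0$ depends only on $\alpha,C_0,\kappa,\ell_{ex},\ell_{dm}$ and $|\Omega|$. -/

import Mathlib

open MeasureTheory

noncomputable section

namespace Micromag

/-- Three-dimensional Euclidean space. -/
abbrev E3 := EuclideanSpace ℝ (Fin 3)

/-- A finite regular (conforming) tetrahedral mesh. A cell is given by its set of vertices, which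
are four affinely independent points; the closed tetrahedron itself is the convex hull of the cell.
Any two tetrahedra meet at most in the common face spanned by their common vertices. -/
structure TetMesh where
  cells : Finset (Finset E3)
  card_eq_four : ∀ K ∈ cells, K.card = 4
  affineIndependent : ∀ K ∈ cells, AffineIndependent ℝ ((↑) : K → E3)
  conforming : ∀ K ∈ cells, ∀ L ∈ cells,
    convexHull ℝ (K : Set E3) ∩ convexHull ℝ (L : Set E3) ⊆
      convexHull ℝ ((K : Set E3) ∩ (L : Set E3))

namespace TetMesh

/-- The union of the closed tetrahedra of the mesh. -/
def carrier (𝒯 : TetMesh) : Set E3 := ⋃ K ∈ 𝒯.cells, convexHull ℝ (K : Set E3)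

/-- `𝒯` is a mesh of the polyhedral open set `Ω`: the closed tetrahedra fill the closure of `Ω`,
and `Ω` is the interior of its closure. -/
def IsMeshOf (𝒯 : TetMesh) (Ω : Set E3) : Prop :=
  closure Ω = 𝒯.carrier ∧ Ω = interior (closure Ω)

/-- The set of vertices of the mesh. -/
def nodes (𝒯 : TetMesh) : Set E3 := {z | ∃ K ∈ 𝒯.cells, z ∈ K}

/-- `κ`-shape-regularity: every tetrahedron `K` contains a ball whose diameter `2 * r` satisfies
`diam K ≤ κ * (2 * r)`. -/
def ShapeRegular (𝒯 : TetMesh) (κ : ℝ) : Prop :=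
  ∀ K ∈ 𝒯.cells, ∃ x : E3, ∃ r : ℝ, 0 < r ∧
    Metric.closedBall x r ⊆ convexHull ℝ (K : Set E3) ∧
    Metric.diam (convexHull ℝ (K : Set E3)) ≤ κ * (2 * r)

/-- `κ`-quasi-uniformity of a mesh with mesh size `h`. -/
def QuasiUniform (𝒯 : TetMesh) (κ h : ℝ) : Prop :=
  𝒯.ShapeRegular κ ∧
    ∀ K ∈ 𝒯.cells, κ⁻¹ * h ≤ Metric.diam (convexHull ℝ (K : Set E3)) ∧
      Metric.diam (convexHull ℝ (K : Set E3)) ≤ h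

/-- Membership in the space of globally continuous, piecewise affine functions on the mesh. Only the
values on the closed polyhedron matter. For values in `E3` this is the vector-valued space `(𝒮¹)³`. -/
def IsP1 {F : Type*} [NormedAddCommGroup F] [NormedSpace ℝ F] (𝒯 : TetMesh) (u : E3 → F) : Prop :=
  ContinuousOn u 𝒯.carrier ∧
    ∀ K ∈ 𝒯.cells, ∃ A : E3 →ᵃ[ℝ] F, Set.EqOn u A (convexHull ℝ (K : Set E3))

/-- `φ` is the nodal hat function of the vertex `z`. -/
def IsHat (𝒯 : TetMesh) (z : E3) (φ : E3 → ℝ) : Prop :=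
  𝒯.IsP1 φ ∧ φ z = 1 ∧ ∀ z' ∈ 𝒯.nodes, z' ≠ z → φ z' = 0

/-- The set of admissible discrete magnetizations. -/
def Magnetization (𝒯 : TetMesh) : Set (E3 → E3) :=
  {φ | 𝒯.IsP1 φ ∧ ∀ z ∈ 𝒯.nodes, ‖φ z‖ = 1}

/-- The discrete tangent space of `ψ`. -/
def Tangent (𝒯 : TetMesh) (ψ : E3 → E3) : Set (E3 → E3) :=
  {φ | 𝒯.IsP1 φ ∧ ∀ z ∈ 𝒯.nodes, inner ℝ (ψ z) (φ z) = 0}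

end TetMesh

/-- The standard basis vectors. -/
def e (i : Fin 3) : E3 := EuclideanSpace.single i 1

/-- The partial derivative `∂ᵢ u`. For piecewise affine continuous functions, the classical
derivative exists almost everywhere and coincides with the weak derivative. -/
def pd {F : Type*} [NormedAddCommGroup F] [NormedSpace ℝ F] (i : Fin 3) (u : E3 → F) (x : E3) : F :=
  fderiv ℝ u x (e i)

/-- The Frobenius product `∇u(x) : ∇w(x)`. -/
def gradDot {F : Type*} [NormedAddCommGroup F] [InnerProductSpace ℝ F]
    (u w : E3 → F) (x : E3) : ℝ :=
  ∑ i : Fin 3, inner ℝ (pd i u x) (pd i w x)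

/-- The curl of a vector field; `pd i u x j` is `∂ᵢ uⱼ (x)`. -/
def curl (u : E3 → E3) (x : E3) : E3 :=
  !₂[pd 1 u x 2 - pd 2 u x 1, pd 2 u x 0 - pd 0 u x 2, pd 0 u x 1 - pd 1 u x 0]

/-- The cross product of vectors in Euclidean space. -/
def cross (a b : E3) : E3 := WithLp.toLp 2 (crossProduct a.ofLp b.ofLp)

/-- The `L²(Ω)` scalar product of vector fields. -/
def l2 (Ω : Set E3) (u w : E3 → E3) : ℝ := ∫ x in Ω, inner ℝ (u x) (w x)

/-- The `L²(Ω)` scalar product of the gradients. -/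
def gradL2 {F : Type*} [NormedAddCommGroup F] [InnerProductSpace ℝ F]
    (Ω : Set E3) (u w : E3 → F) : ℝ := ∫ x in Ω, gradDot u w x

/-- The `H¹(Ω)` norm. -/
def h1Norm (Ω : Set E3) (u : E3 → E3) : ℝ := √(l2 Ω u u + gradL2 Ω u u)

/-- The angle condition: the off-diagonal entries of the stiffness matrix are nonpositive. -/
def AngleCondition (𝒯 : TetMesh) (Ω : Set E3) : Prop :=
  ∀ z ∈ 𝒯.nodes, ∀ z' ∈ 𝒯.nodes, z ≠ z' →
    ∀ φ φ' : E3 → ℝ, 𝒯.IsHat z φ → 𝒯.IsHat z' φ' → gradL2 Ω φ φ' ≤ 0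

/-- The energy, consisting of the exchange energy and the bulk Dzyaloshinskii–Moriya interaction. -/
def energy (Ω : Set E3) (lex ldm : ℝ) (m : E3 → E3) : ℝ :=
  lex ^ 2 / 2 * gradL2 Ω m m + ldm / 2 * l2 Ω (curl m) m

/-- The cut-off function `W_M`. -/
def cutoff (α k M s : ℝ) : ℝ :=
  if 0 ≤ s then α + k * min s M / 2 else 2 * α ^ 2 / (2 * α + k * min (-s) M)

/-- The cut-off level `M(k) = |k log k|⁻¹`. -/
def cutLevel (k : ℝ) : ℝ := |k * Real.log k|⁻¹

/-- The stabilization function `ρ(k) = |k log k|`. -/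
def rho (k : ℝ) : ℝ := |k * Real.log k|

/-- The function `λ(m) = - lex² |∇m|² - ldm (curl m) · m`. -/
def multiplier (lex ldm : ℝ) (m : E3 → E3) (x : E3) : ℝ :=
  -lex ^ 2 * gradDot m m x - ldm * inner ℝ (curl m x) (m x)

/-- The weighted field `W_{M(k)}(λ(m)) v`. -/
def weighted (α lex ldm k : ℝ) (m v : E3 → E3) (x : E3) : E3 :=
  cutoff α k (cutLevel k) (multiplier lex ldm m x) • v x

/-- The variational equation for the tangential update `v` in one step of TPS2. -/
def StepEquation (𝒯 : TetMesh) (Ω : Set E3) (α lex ldm k : ℝ) (m v : E3 → E3) : Prop :=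
  ∀ φ ∈ 𝒯.Tangent m,
    l2 Ω (weighted α lex ldm k m v) φ
      + l2 Ω (fun x => cross (m x) (v x)) φ
      + lex ^ 2 / 2 * k * (1 + rho k) * gradL2 Ω v φ
      + ldm / 4 * k * l2 Ω v (curl φ)
      + ldm / 4 * k * l2 Ω (curl v) φ
    = -lex ^ 2 * gradL2 Ω m φ
      - ldm / 2 * l2 Ω (curl m) φ
      - ldm / 2 * l2 Ω m (curl φ)

/-- `m 0, …, m N` and `v 0, …, v (N - 1)` are iterates of the (almost) second-order tangent plane
scheme TPS2 with time-step size `k`. -/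
structure IsTPS2 (𝒯 : TetMesh) (Ω : Set E3) (α lex ldm k : ℝ) (N : ℕ) (m v : ℕ → E3 → E3) :
    Prop where
  initial : m 0 ∈ 𝒯.Magnetization
  tangent : ∀ i < N, v i ∈ 𝒯.Tangent (m i)
  step : ∀ i < N, StepEquation 𝒯 Ω α lex ldm k (m i) (v i)
  update_mem : ∀ i < N, m (i + 1) ∈ 𝒯.Magnetization
  update : ∀ i < N, ∀ z ∈ 𝒯.nodes,
    m (i + 1) z = ‖m i z + k • v i z‖⁻¹ • (m i z + k • v i z)

end Micromag

end

open Micromag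

/-! Write $w=m+kv$ for one step before normalization. The energy is quadratic, and the right-hand
side of the step equation tested with $v$ is minus its derivative at $m$ in direction $v$. Testing
with $\phi=v$ kills the cross product, and after multiplication by $k$ the implicit terms of order
$k^2$ cancel $k^2\mathcal E(v)$ exactly. This leaves the identity $\mathcal
E(w)+k(Wv,v)+\frac{\ell_{ex}^2}{2}\rho k^2\|\nabla v\|^2=\mathcal E(m)$.

It remains to compare $\mathcal E(m')$ with $\mathcal E(w)$, where $m'$ is the nodal normalization
of $w$. Tangency gives $|w(z)|\ge1$ at the nodes, and outside the unit ball radial projection is a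
contraction. Under the angle condition the Dirichlet energy is a nonnegative combination of squared
nodal differences, so it does not grow (`gradL2_le_of_contraction`). The curl term grows by at most
$O(h^{-1}k^2\|v\|^2)$ (`curl_projection_le`): the nodal error $|w|-1$ is bounded by both $k^2|v|^2$
and $k|v|$, an inverse estimate bounds the curl, and nodal maxima are controlled by $L^2$ norms cell
by cell.

Summation gives the energy law. For stability, small $k$ yields $W\ge\alpha/2$, the condition $k\le
C'h$ absorbs the error into the dissipation, and Young's inequality absorbs the indefinite curl
energy into the exchange energy. -/

noncomputable section

namespace Micromag

/-! ### Barycentric coordinates. -/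

namespace TetMesh

variable {𝒯 : TetMesh} {K L : Finset E3}

/-- The vertices of a cell, as an affine basis of space. -/
def cellBasis (hK : K ∈ 𝒯.cells) : AffineBasis K ℝ E3 where
  toFun := (↑)
  ind' := 𝒯.affineIndependent K hK
  tot' := by
    rw [(𝒯.affineIndependent K hK).affineSpan_eq_top_iff_card_eq_finrank_add_one]
    simp [𝒯.card_eq_four K hK]

lemma cellBasis_apply (hK : K ∈ 𝒯.cells) (z : K) : cellBasis hK z = z := rfl

lemma range_cellBasis (hK : K ∈ 𝒯.cells) : Set.range (cellBasis hK) = K := by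
  ext x
  simp [cellBasis_apply]

open Classical in
/-- The barycentric coordinate of the cell `K` with respect to the vertex `z`; it vanishes if `z` is
not a vertex of `K`. -/
def bary (𝒯 : TetMesh) (K : Finset E3) (z : E3) : E3 →ᵃ[ℝ] ℝ :=
  if h : K ∈ 𝒯.cells ∧ z ∈ K then (cellBasis h.1).coord ⟨z, h.2⟩ else 0

lemma bary_of_mem (hK : K ∈ 𝒯.cells) {z : E3} (hz : z ∈ K) :
    𝒯.bary K z = (cellBasis hK).coord ⟨z, hz⟩ := by
  simp [bary, hK, hz]

lemma bary_of_notMem {z : E3} (hz : z ∉ K) : 𝒯.bary K z = 0 := by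
  simp [bary, hz]

lemma bary_self (hK : K ∈ 𝒯.cells) {z : E3} (hz : z ∈ K) : 𝒯.bary K z z = 1 := by
  rw [bary_of_mem hK hz]
  exact (cellBasis hK).coord_apply_eq ⟨z, hz⟩

lemma bary_vertex_of_ne (hK : K ∈ 𝒯.cells) {z z' : E3} (hz' : z' ∈ K) (hne : z ≠ z') :
    𝒯.bary K z z' = 0 := by
  by_cases hz : z ∈ K
  · rw [bary_of_mem hK hz]
    exact (cellBasis hK).coord_apply_ne (i := ⟨z, hz⟩) (j := ⟨z', hz'⟩) (by simpa using hne)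
  · simp [bary_of_notMem hz]

lemma sum_bary (hK : K ∈ 𝒯.cells) (x : E3) : ∑ z ∈ K, 𝒯.bary K z x = 1 := by
  rw [← (cellBasis hK).sum_coord_apply_eq_one x, ← Finset.sum_coe_sort K]
  exact Finset.sum_congr rfl fun z _ => by rw [bary_of_mem hK z.2]

lemma sum_bary_smul {F : Type*} [AddCommGroup F] [Module ℝ F] (hK : K ∈ 𝒯.cells)
    (A : E3 →ᵃ[ℝ] F) (x : E3) : A x = ∑ z ∈ K, 𝒯.bary K z x • A z := by
  have h1 := (cellBasis hK).sum_coord_apply_eq_one x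
  conv_lhs => rw [← (cellBasis hK).affineCombination_coord_eq_self x]
  rw [Finset.map_affineCombination _ _ _ h1,
    Finset.affineCombination_eq_linear_combination _ _ _ h1, ← Finset.sum_coe_sort K]
  exact Finset.sum_congr rfl fun z _ => by
    rw [bary_of_mem hK z.2]; rfl

lemma bary_nonneg (hK : K ∈ 𝒯.cells) (z : E3) {x : E3} (hx : x ∈ convexHull ℝ (K : Set E3)) :
    0 ≤ 𝒯.bary K z x := by
  by_cases hz : z ∈ K
  · rw [← range_cellBasis hK, AffineBasis.convexHull_eq_nonneg_coord] at hx
    rw [bary_of_mem hK hz]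
    exact hx _
  · simp [bary_of_notMem hz]

lemma bary_le_one (hK : K ∈ 𝒯.cells) (z : E3) {x : E3} (hx : x ∈ convexHull ℝ (K : Set E3)) :
    𝒯.bary K z x ≤ 1 := by
  by_cases hz : z ∈ K
  · rw [← sum_bary hK x]
    exact Finset.single_le_sum (f := fun z => 𝒯.bary K z x)
      (fun z _ => bary_nonneg hK z hx) hz
  · simp [bary_of_notMem hz]

lemma bary_pos (hK : K ∈ 𝒯.cells) {z : E3} (hz : z ∈ K) {x : E3}
    (hx : x ∈ interior (convexHull ℝ (K : Set E3))) : 0 < 𝒯.bary K z x := by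
  rw [← range_cellBasis hK, AffineBasis.interior_convexHull] at hx
  rw [bary_of_mem hK hz]
  exact hx _

/-- Barycentric coordinates agree on the intersection of two cells. -/
lemma bary_eq_bary (hK : K ∈ 𝒯.cells) (hL : L ∈ 𝒯.cells) (z : E3) {x : E3}
    (hxK : x ∈ convexHull ℝ (K : Set E3)) (hxL : x ∈ convexHull ℝ (L : Set E3)) :
    𝒯.bary K z x = 𝒯.bary L z x := by
  have hx := 𝒯.conforming K hK L hL ⟨hxK, hxL⟩
  -- By conformity `x` lies in the hull of the common vertices, so agreement at those vertices
  -- suffices.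
  refine AffineMap.eqOn_affineSpan (s := (K : Set E3) ∩ L) ?_ (convexHull_subset_affineSpan _ hx)
  rintro z' ⟨h1, h2⟩
  by_cases hzz : z = z'
  · subst hzz
    rw [bary_self hK h1, bary_self hL h2]
  · rw [bary_vertex_of_ne hK h1 hzz, bary_vertex_of_ne hL h2 hzz]

/-! ### Open cells and the splitting of integrals over the domain. -/

/-- The interior of the tetrahedron spanned by `K`. -/
def openCell (K : Finset E3) : Set E3 := interior (convexHull ℝ (K : Set E3))

lemma openCell_subset (K : Finset E3) : openCell K ⊆ convexHull ℝ (K : Set E3) := interior_subset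

lemma isOpen_openCell (K : Finset E3) : IsOpen (openCell K) := isOpen_interior

lemma measurableSet_openCell (K : Finset E3) : MeasurableSet (openCell K) :=
  (isOpen_openCell K).measurableSet

lemma isCompact_cell (K : Finset E3) : IsCompact (convexHull ℝ (K : Set E3)) :=
  K.finite_toSet.isCompact_convexHull ℝ

lemma openCell_ae_eq (K : Finset E3) :
    openCell K =ᵐ[volume] (convexHull ℝ (K : Set E3)) :=
  interior_ae_eq_of_null_frontier ((convex_convexHull ℝ _).addHaar_frontier volume)

lemma volume_openCell_lt_top (K : Finset E3) : volume (openCell K) < ⊤ :=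
  (measure_mono (openCell_subset K)).trans_lt (isCompact_cell K).measure_lt_top

/-- Some vertex of `K` is not in `L`. Its coordinate is positive inside `K`, but on the intersection
it agrees with the coordinate from `L`, which is zero. -/
lemma disjoint_openCell (hK : K ∈ 𝒯.cells) (hL : L ∈ 𝒯.cells) (hne : K ≠ L) :
    Disjoint (openCell K) (openCell L) := by
  rw [Set.disjoint_left]
  intro x hxK hxL
  have hsub : ¬ K ⊆ L := fun hs => hne <| Finset.eq_of_subset_of_card_le hs <| by
    rw [𝒯.card_eq_four K hK, 𝒯.card_eq_four L hL]
  obtain ⟨z, hzK, hzL⟩ := Finset.not_subset.1 hsub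
  have h1 := bary_pos hK hzK hxK
  rw [bary_eq_bary hK hL z (openCell_subset K hxK) (openCell_subset L hxL),
    bary_of_notMem hzL] at h1
  simp at h1

lemma openCell_subset_domain {Ω : Set E3} (hΩ : 𝒯.IsMeshOf Ω) (hK : K ∈ 𝒯.cells) :
    openCell K ⊆ Ω := by
  rw [hΩ.2, hΩ.1]
  exact interior_mono (Set.subset_biUnion_of_mem (u := fun K : Finset E3 =>
    convexHull ℝ (K : Set E3)) hK)

/-- Frontiers of convex sets are null, so open and closed cells are interchangeable under the
integral. -/
lemma domain_ae_eq {Ω : Set E3} (hΩ : 𝒯.IsMeshOf Ω) :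
    Ω =ᵐ[volume] ⋃ K ∈ 𝒯.cells, openCell K := by
  have h1 : (⋃ K ∈ 𝒯.cells, openCell K) ⊆ Ω := Set.iUnion₂_subset fun K hK =>
    openCell_subset_domain hΩ hK
  have h2 : (⋃ K ∈ 𝒯.cells, openCell K) =ᵐ[volume]
      ⋃ K ∈ 𝒯.cells, convexHull ℝ (K : Set E3) :=
    Finset.eventuallyEq_iUnion _ fun K _ => openCell_ae_eq K
  refine Filter.EventuallyLE.antisymm ?_ h1.eventuallyLE
  refine Filter.EventuallyLE.trans_eq ?_ h2.symm
  exact (subset_closure.trans hΩ.1.subset).eventuallyLE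

lemma integrableOn_domain {Ω : Set E3} (hΩ : 𝒯.IsMeshOf Ω) {f : E3 → ℝ}
    (hf : ∀ K ∈ 𝒯.cells, IntegrableOn f (openCell K)) : IntegrableOn f Ω := by
  rw [integrableOn_congr_set_ae (domain_ae_eq hΩ), integrableOn_finset_iUnion]
  exact hf

lemma setIntegral_domain {Ω : Set E3} (hΩ : 𝒯.IsMeshOf Ω) {f : E3 → ℝ}
    (hf : ∀ K ∈ 𝒯.cells, IntegrableOn f (openCell K)) :
    ∫ x in Ω, f x = ∑ K ∈ 𝒯.cells, ∫ x in openCell K, f x := by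
  rw [setIntegral_congr_set (domain_ae_eq hΩ)]
  exact integral_biUnion_finset _ (fun K _ => measurableSet_openCell K)
    (fun K hK L hL hne => disjoint_openCell hK hL hne) hf

lemma ae_mem_openCell {Ω : Set E3} (hΩ : 𝒯.IsMeshOf Ω) :
    ∀ᵐ x ∂volume.restrict Ω, ∃ K ∈ 𝒯.cells, x ∈ openCell K := by
  rw [Measure.restrict_congr_set (domain_ae_eq hΩ)]
  filter_upwards [ae_restrict_mem (Finset.measurableSet_biUnion _
    fun K _ => measurableSet_openCell K)] with x hx
  simpa using hx

lemma volume_domain_lt_top {Ω : Set E3} (hΩ : 𝒯.IsMeshOf Ω) : volume Ω < ⊤ := by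
  rw [measure_congr (domain_ae_eq hΩ)]
  exact (measure_biUnion_finset_le _ _).trans_lt
    (ENNReal.sum_lt_top.2 fun K _ => volume_openCell_lt_top K)

/-! ### Gradients of barycentric coordinates. -/

/-- The `i`-th partial derivative of a barycentric coordinate. -/
def slope (𝒯 : TetMesh) (K : Finset E3) (z : E3) (i : Fin 3) : ℝ := (𝒯.bary K z).linear (e i)

lemma slope_eq (K : Finset E3) (z : E3) (i : Fin 3) (x : E3) (t : ℝ) :
    𝒯.bary K z (x + t • e i) = 𝒯.bary K z x + t * 𝒯.slope K z i := by
  have := (𝒯.bary K z).map_vadd x (t • e i)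
  simp only [vadd_eq_add, map_smul, smul_eq_mul] at this
  rw [add_comm x, this, slope, add_comm]

lemma slope_of_notMem {z : E3} (hz : z ∉ K) (i : Fin 3) : 𝒯.slope K z i = 0 := by
  simp [slope, bary_of_notMem hz]

lemma sum_slope (hK : K ∈ 𝒯.cells) (i : Fin 3) : ∑ z ∈ K, 𝒯.slope K z i = 0 := by
  have h1 := sum_bary hK (0 + (1 : ℝ) • e i)
  simp only [slope_eq, Finset.sum_add_distrib, sum_bary hK, one_mul] at h1
  linarith

lemma linear_eq_sum_slope {F : Type*} [AddCommGroup F] [Module ℝ F] (hK : K ∈ 𝒯.cells)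
    (A : E3 →ᵃ[ℝ] F) (i : Fin 3) : A.linear (e i) = ∑ z ∈ K, 𝒯.slope K z i • A z := by
  have h1 : A.linear (e i) = A (0 + (1 : ℝ) • e i) - A 0 := by
    have := A.map_vadd 0 (e i)
    simp only [vadd_eq_add, add_zero] at this
    simp [this]
  rw [h1, sum_bary_smul hK A, sum_bary_smul hK A 0, ← Finset.sum_sub_distrib]
  refine Finset.sum_congr rfl fun z _ => ?_
  rw [slope_eq, ← sub_smul]
  congr 1
  ring

lemma norm_e (i : Fin 3) : ‖e i‖ = 1 := by simp [e]

/-- Along a diameter of the inscribed ball, of length `2 * r`, the coordinate stays in $[0,1]$, so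
its slope is at most $1/(2r)$. Quasi-uniformity gives $2r\ge h/\kappa^2$. -/
lemma abs_slope_le {κ h : ℝ} (hκ : 1 ≤ κ) (hh : 0 < h) (hq : 𝒯.QuasiUniform κ h)
    (hK : K ∈ 𝒯.cells) (z : E3) (i : Fin 3) : |𝒯.slope K z i| ≤ κ ^ 2 / h := by
  obtain ⟨x, r, hr, hball, hdiam⟩ := hq.1 K hK
  have hd := (hq.2 K hK).1
  have hmem : ∀ t : ℝ, |t| ≤ r → x + t • e i ∈ convexHull ℝ (K : Set E3) := fun t ht => by
    apply hball
    simpa [norm_smul, norm_e] using ht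
  have hp := hmem r (abs_of_pos hr).le
  have hn := hmem (-r) (by rw [abs_neg, abs_of_pos hr])
  have a1 := bary_nonneg hK z hp
  have a2 := bary_le_one hK z hp
  have a3 := bary_nonneg hK z hn
  have a4 := bary_le_one hK z hn
  rw [slope_eq] at a1 a2 a3 a4
  have hs : 2 * r * |𝒯.slope K z i| ≤ 1 := by
    rcases abs_cases (𝒯.slope K z i) with ⟨h1, _⟩ | ⟨h1, _⟩ <;> rw [h1] <;> linarith
  have hκ0 : 0 < κ := by linarith
  have hr2 : h ≤ κ ^ 2 * (2 * r) := by
    have h3 : κ⁻¹ * h ≤ κ * (2 * r) := hd.trans hdiam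
    calc h = κ * (κ⁻¹ * h) := by field_simp
      _ ≤ κ * (κ * (2 * r)) := by gcongr
      _ = _ := by ring
  rw [le_div_iff₀ hh]
  calc |𝒯.slope K z i| * h ≤ |𝒯.slope K z i| * (κ ^ 2 * (2 * r)) := by gcongr
    _ = κ ^ 2 * (2 * r * |𝒯.slope K z i|) := by ring
    _ ≤ κ ^ 2 * 1 := by gcongr
    _ = κ ^ 2 := mul_one _

/-! ### Piecewise affine functions and inverse estimates. -/

section P1

variable {F : Type*} [NormedAddCommGroup F] [NormedSpace ℝ F] {u w : E3 → F}

lemma mem_cell {z : E3} (hz : z ∈ K) : z ∈ convexHull ℝ (K : Set E3) :=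
  subset_convexHull ℝ _ hz

lemma IsP1.add (hu : 𝒯.IsP1 u) (hw : 𝒯.IsP1 w) : 𝒯.IsP1 (fun x => u x + w x) := by
  refine ⟨hu.1.add hw.1, fun K hK => ?_⟩
  obtain ⟨A, hA⟩ := hu.2 K hK
  obtain ⟨B, hB⟩ := hw.2 K hK
  exact ⟨A + B, fun x hx => by simp [hA hx, hB hx]⟩

lemma IsP1.smul (c : ℝ) (hu : 𝒯.IsP1 u) : 𝒯.IsP1 (fun x => c • u x) := by
  refine ⟨hu.1.const_smul c, fun K hK => ?_⟩
  obtain ⟨A, hA⟩ := hu.2 K hK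
  exact ⟨c • A, fun x hx => by simp [hA hx]⟩

lemma IsP1.eq_sum_bary (hu : 𝒯.IsP1 u) (hK : K ∈ 𝒯.cells) {x : E3}
    (hx : x ∈ convexHull ℝ (K : Set E3)) : u x = ∑ z ∈ K, 𝒯.bary K z x • u z := by
  obtain ⟨A, hA⟩ := hu.2 K hK
  rw [hA hx, sum_bary_smul hK A]
  exact Finset.sum_congr rfl fun z hz => by rw [hA (mem_cell hz)]

lemma IsP1.pd_eq (hu : 𝒯.IsP1 u) (hK : K ∈ 𝒯.cells) {x : E3} (hx : x ∈ openCell K)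
    (i : Fin 3) : pd i u x = ∑ z ∈ K, 𝒯.slope K z i • u z := by
  obtain ⟨A, hA⟩ := hu.2 K hK
  have h1 : u =ᶠ[nhds x] A := by
    filter_upwards [(isOpen_openCell K).mem_nhds hx] with y hy using hA (openCell_subset K hy)
  have h2 : HasFDerivAt A (LinearMap.toContinuousLinearMap A.linear) x := by
    rw [A.decomp]
    exact (LinearMap.toContinuousLinearMap A.linear).hasFDerivAt.add_const _
  rw [pd, (h2.congr_of_eventuallyEq h1).fderiv]
  change A.linear (e i) = _
  rw [linear_eq_sum_slope hK A]
  exact Finset.sum_congr rfl fun z hz => by rw [hA (mem_cell hz)]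

lemma IsP1.norm_le (hu : 𝒯.IsP1 u) (hK : K ∈ 𝒯.cells) {x : E3}
    (hx : x ∈ convexHull ℝ (K : Set E3)) {B : ℝ} (hB : ∀ z ∈ K, ‖u z‖ ≤ B) : ‖u x‖ ≤ B := by
  rw [hu.eq_sum_bary hK hx]
  calc ‖∑ z ∈ K, 𝒯.bary K z x • u z‖ ≤ ∑ z ∈ K, 𝒯.bary K z x * B := by
        refine norm_sum_le_of_le _ fun z hz => ?_
        rw [norm_smul, Real.norm_of_nonneg (bary_nonneg hK z hx)]
        exact mul_le_mul_of_nonneg_left (hB z hz) (bary_nonneg hK z hx)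
    _ = B := by rw [← Finset.sum_mul, sum_bary hK, one_mul]

lemma IsP1.norm_pd_le {κ h : ℝ} (hκ : 1 ≤ κ) (hh : 0 < h) (hq : 𝒯.QuasiUniform κ h)
    (hu : 𝒯.IsP1 u) (hK : K ∈ 𝒯.cells) {x : E3} (hx : x ∈ openCell K) (i : Fin 3) {B : ℝ}
    (hB : ∀ z ∈ K, ‖u z‖ ≤ B) : ‖pd i u x‖ ≤ 4 * (κ ^ 2 / h) * B := by
  rw [hu.pd_eq hK hx]
  calc ‖∑ z ∈ K, 𝒯.slope K z i • u z‖ ≤ ∑ z ∈ K, κ ^ 2 / h * B := by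
        refine norm_sum_le_of_le _ fun z hz => ?_
        rw [norm_smul, Real.norm_eq_abs]
        exact mul_le_mul (abs_slope_le hκ hh hq hK z i) (hB z hz) (norm_nonneg _) (by positivity)
    _ = _ := by rw [Finset.sum_const, 𝒯.card_eq_four K hK]; simp; ring

lemma IsP1.exists_affine_openCell (hu : 𝒯.IsP1 u) (hK : K ∈ 𝒯.cells) :
    ∃ A : E3 → F, Continuous A ∧ Set.EqOn u A (openCell K) := by
  obtain ⟨A, hA⟩ := hu.2 K hK
  exact ⟨A, A.continuous_of_finiteDimensional, hA.mono (openCell_subset K)⟩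

end P1

end TetMesh

/-! ### Nodal hat functions. -/

namespace TetMesh

variable {𝒯 : TetMesh} {K L : Finset E3}

lemma isClosed_cell (K : Finset E3) : IsClosed (convexHull ℝ (K : Set E3)) :=
  (isCompact_cell K).isClosed

open Classical in
/-- The nodal hat function of the vertex `z`. -/
def hat (𝒯 : TetMesh) (z x : E3) : ℝ :=
  if h : ∃ K ∈ 𝒯.cells, x ∈ convexHull ℝ (K : Set E3) then 𝒯.bary h.choose z x else 0

/-- The choice of cell in `hat` is immaterial because coordinates agree on intersections of cells.
-/
lemma hat_eq_bary (hK : K ∈ 𝒯.cells) (z : E3) :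
    Set.EqOn (𝒯.hat z) (𝒯.bary K z) (convexHull ℝ (K : Set E3)) := by
  intro x hx
  have h : ∃ K ∈ 𝒯.cells, x ∈ convexHull ℝ (K : Set E3) := ⟨K, hK, hx⟩
  rw [hat, dif_pos h]
  exact bary_eq_bary h.choose_spec.1 hK z h.choose_spec.2 hx

lemma hat_vertex_of_ne {z z' : E3} (hz' : z' ∈ 𝒯.nodes) (hne : z ≠ z') : 𝒯.hat z z' = 0 := by
  obtain ⟨K, hK, hzK⟩ := hz'
  rw [hat_eq_bary hK z (mem_cell hzK), bary_vertex_of_ne hK hzK hne]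

lemma hat_self {z : E3} (hz : z ∈ 𝒯.nodes) : 𝒯.hat z z = 1 := by
  obtain ⟨K, hK, hzK⟩ := hz
  rw [hat_eq_bary hK z (mem_cell hzK), bary_self hK hzK]

lemma isP1_hat (z : E3) : 𝒯.IsP1 (𝒯.hat z) := by
  refine ⟨?_, fun K hK => ⟨𝒯.bary K z, hat_eq_bary hK z⟩⟩
  have h1 : 𝒯.carrier = ⋃ K : 𝒯.cells, convexHull ℝ ((K : Finset E3) : Set E3) := by
    rw [carrier, Set.iUnion_subtype]
  rw [h1]
  refine (locallyFinite_of_finite _).continuousOn_iUnion (fun K => isClosed_cell _) fun K => ?_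
  exact (𝒯.bary K z).continuous_of_finiteDimensional.continuousOn.congr (hat_eq_bary K.2 z)

lemma isHat_hat {z : E3} (hz : z ∈ 𝒯.nodes) : 𝒯.IsHat z (𝒯.hat z) :=
  ⟨isP1_hat z, hat_self hz, fun _ hz' hne => hat_vertex_of_ne hz' hne.symm⟩

lemma integrableOn_openCell_of_eqOn {f g : E3 → ℝ} (hg : Continuous g)
    (hfg : Set.EqOn f g (openCell K)) : IntegrableOn f (openCell K) := by
  rw [integrableOn_congr_fun hfg (measurableSet_openCell K)]
  exact (hg.continuousOn.integrableOn_compact (isCompact_cell K)).mono_set (openCell_subset K)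

/-! ### The stiffness matrix and the angle condition. -/

section Grad

variable {F : Type*} [NormedAddCommGroup F] [InnerProductSpace ℝ F] {u w : E3 → F}

lemma IsP1.gradDot_eqOn (hu : 𝒯.IsP1 u) (hw : 𝒯.IsP1 w) (hK : K ∈ 𝒯.cells) :
    Set.EqOn (gradDot u w) (fun _ => ∑ i : Fin 3,
      inner ℝ (∑ z ∈ K, 𝒯.slope K z i • u z) (∑ z ∈ K, 𝒯.slope K z i • w z)) (openCell K) := by
  intro x hx
  simp only [gradDot, hu.pd_eq hK hx, hw.pd_eq hK hx]

lemma IsP1.integrableOn_gradDot (hu : 𝒯.IsP1 u) (hw : 𝒯.IsP1 w) (hK : K ∈ 𝒯.cells) :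
    IntegrableOn (gradDot u w) (openCell K) :=
  integrableOn_openCell_of_eqOn continuous_const (hu.gradDot_eqOn hw hK)

lemma IsP1.gradL2_eq {Ω : Set E3} (hΩ : 𝒯.IsMeshOf Ω) (hu : 𝒯.IsP1 u) (hw : 𝒯.IsP1 w) :
    gradL2 Ω u w = ∑ K ∈ 𝒯.cells, volume.real (openCell K) * ∑ i : Fin 3,
      inner ℝ (∑ z ∈ K, 𝒯.slope K z i • u z) (∑ z ∈ K, 𝒯.slope K z i • w z) := by
  rw [gradL2, setIntegral_domain hΩ fun K hK => hu.integrableOn_gradDot hw hK]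
  refine Finset.sum_congr rfl fun K hK => ?_
  rw [setIntegral_congr_fun (measurableSet_openCell K) (hu.gradDot_eqOn hw hK),
    setIntegral_const, smul_eq_mul]

open Classical in
/-- The finite set of vertices of the mesh. -/
def nodeFinset (𝒯 : TetMesh) : Finset E3 := 𝒯.cells.biUnion id

lemma mem_nodeFinset {z : E3} : z ∈ 𝒯.nodeFinset ↔ z ∈ 𝒯.nodes := by
  simp [nodeFinset, nodes]

lemma subset_nodeFinset (hK : K ∈ 𝒯.cells) : K ⊆ 𝒯.nodeFinset := fun _ hz =>
  mem_nodeFinset.2 ⟨K, hK, hz⟩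

/-- The entries of the stiffness matrix. -/
def stiffness (𝒯 : TetMesh) (z z' : E3) : ℝ :=
  ∑ K ∈ 𝒯.cells, volume.real (openCell K) * ∑ i : Fin 3, 𝒯.slope K z i * 𝒯.slope K z' i

lemma sum_slope_smul_hat (hK : K ∈ 𝒯.cells) (z : E3) (i : Fin 3) :
    ∑ z' ∈ K, 𝒯.slope K z' i • 𝒯.hat z z' = 𝒯.slope K z i := by
  by_cases hz : z ∈ K
  · rw [Finset.sum_eq_single_of_mem z hz fun z' hz' hne => by
      rw [hat_vertex_of_ne ⟨K, hK, hz'⟩ hne.symm, smul_zero], hat_self ⟨K, hK, hz⟩]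
    simp
  · rw [slope_of_notMem hz]
    refine Finset.sum_eq_zero fun z' hz' => ?_
    rw [hat_vertex_of_ne ⟨K, hK, hz'⟩ (by rintro rfl; exact hz hz'), smul_zero]

lemma gradL2_hat {Ω : Set E3} (hΩ : 𝒯.IsMeshOf Ω) (z z' : E3) :
    gradL2 Ω (𝒯.hat z) (𝒯.hat z') = 𝒯.stiffness z z' := by
  rw [(isP1_hat z).gradL2_eq hΩ (isP1_hat z'), stiffness]
  refine Finset.sum_congr rfl fun K hK => ?_
  simp only [sum_slope_smul_hat hK, RCLike.inner_apply, conj_trivial]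
  exact congrArg _ (Finset.sum_congr rfl fun i _ => mul_comm _ _)

lemma stiffness_nonpos {Ω : Set E3} (hΩ : 𝒯.IsMeshOf Ω) (hA : AngleCondition 𝒯 Ω) {z z' : E3}
    (hz : z ∈ 𝒯.nodes) (hz' : z' ∈ 𝒯.nodes) (hne : z ≠ z') : 𝒯.stiffness z z' ≤ 0 := by
  rw [← gradL2_hat hΩ]
  exact hA z hz z' hz' hne _ _ (isHat_hat hz) (isHat_hat hz')

/-- The Dirichlet energy in terms of differences of nodal values. -/
lemma IsP1.gradL2_self_eq {Ω : Set E3} (hΩ : 𝒯.IsMeshOf Ω) (hu : 𝒯.IsP1 u) :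
    gradL2 Ω u u = ∑ z ∈ 𝒯.nodeFinset, ∑ z' ∈ 𝒯.nodeFinset,
      -𝒯.stiffness z z' / 2 * ‖u z - u z'‖ ^ 2 := by
  have hsq : ∀ K ∈ 𝒯.cells, ∀ i : Fin 3,
      inner ℝ (∑ z ∈ K, 𝒯.slope K z i • u z) (∑ z ∈ K, 𝒯.slope K z i • u z) =
        ∑ z ∈ 𝒯.nodeFinset, ∑ z' ∈ 𝒯.nodeFinset,
          -(𝒯.slope K z i * 𝒯.slope K z' i) / 2 * ‖u z - u z'‖ ^ 2 := by
    intro K hK i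
    -- As $\sum_z a_z=0$ for the slopes, $|\sum_z
    -- a_zu_z|^2=-\frac12\sum_{z,z'}a_za_{z'}|u_z-u_{z'}|^2$.
    rw [inner_sum_smul_sum_smul_of_sum_eq_zero _ (sum_slope hK i) _ (sum_slope hK i)]
    rw [← Finset.sum_neg_distrib, Finset.sum_div]
    rw [Finset.sum_subset (subset_nodeFinset hK)]
    · refine Finset.sum_congr rfl fun z _ => ?_
      rw [← Finset.sum_neg_distrib, Finset.sum_div, Finset.sum_subset (subset_nodeFinset hK)]
      · exact Finset.sum_congr rfl fun z' _ => by ring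
      · intro z' _ hz'
        simp [slope_of_notMem hz']
    · intro z _ hz
      simp [slope_of_notMem hz]
  rw [hu.gradL2_eq hΩ hu, Finset.sum_congr rfl fun K hK => by
    rw [Finset.sum_congr rfl fun i _ => hsq K hK i, Finset.sum_comm, Finset.mul_sum]]
  rw [Finset.sum_comm]
  refine Finset.sum_congr rfl fun z _ => ?_
  simp_rw [Finset.sum_comm (s := (Finset.univ : Finset (Fin 3))), Finset.mul_sum]
  rw [Finset.sum_comm]
  refine Finset.sum_congr rfl fun z' _ => ?_
  rw [stiffness, ← Finset.sum_neg_distrib, Finset.sum_div, Finset.sum_mul]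
  refine Finset.sum_congr rfl fun K _ => ?_
  rw [Finset.mul_sum, ← Finset.sum_neg_distrib, Finset.sum_div, Finset.sum_mul]
  exact Finset.sum_congr rfl fun i _ => by ring

/-- Under the angle condition, nodewise contractions decrease the Dirichlet energy. -/
lemma IsP1.gradL2_le_of_contraction {Ω : Set E3} (hΩ : 𝒯.IsMeshOf Ω) (hA : AngleCondition 𝒯 Ω)
    (hu : 𝒯.IsP1 u) (hw : 𝒯.IsP1 w)
    (h : ∀ z ∈ 𝒯.nodes, ∀ z' ∈ 𝒯.nodes, ‖u z - u z'‖ ≤ ‖w z - w z'‖) :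
    gradL2 Ω u u ≤ gradL2 Ω w w := by
  rw [hu.gradL2_self_eq hΩ, hw.gradL2_self_eq hΩ]
  refine Finset.sum_le_sum fun z hz => Finset.sum_le_sum fun z' hz' => ?_
  rw [mem_nodeFinset] at hz hz'
  by_cases hne : z = z'
  · simp [hne]
  · have h1 := stiffness_nonpos hΩ hA hz hz' hne
    have h2 := h z hz z' hz'
    gcongr
    linarith

end Grad

/-- The squared right side minus the squared left side is
$(|a|-|b|)^2+2(1-\frac1{|a||b|})(|a||b|-a\cdot b)\ge0$. -/
lemma norm_inv_smul_sub_le {F : Type*} [NormedAddCommGroup F] [InnerProductSpace ℝ F] {a b : F}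
    (ha : 1 ≤ ‖a‖) (hb : 1 ≤ ‖b‖) : ‖‖a‖⁻¹ • a - ‖b‖⁻¹ • b‖ ≤ ‖a - b‖ := by
  have ha0 : 0 < ‖a‖ := by linarith
  have hb0 : 0 < ‖b‖ := by linarith
  refine le_of_sq_le_sq ?_ (norm_nonneg _)
  rw [norm_sub_sq_real, norm_sub_sq_real, norm_smul, norm_smul, real_inner_smul_left,
    real_inner_smul_right, norm_inv, norm_inv, norm_norm, norm_norm, inv_mul_cancel₀ ha0.ne',
    inv_mul_cancel₀ hb0.ne']
  have hab := real_inner_le_norm a b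
  have hst : ‖a‖⁻¹ * ‖b‖⁻¹ ≤ 1 := mul_le_one₀ (inv_le_one_of_one_le₀ ha) (by positivity)
    (inv_le_one_of_one_le₀ hb)
  have h1 : (‖a‖⁻¹ * ‖b‖⁻¹) * (‖a‖ * ‖b‖) = 1 := by field_simp
  have h2 := mul_le_mul_of_nonneg_left hab (sub_nonneg.2 hst)
  nlinarith [sq_nonneg (‖a‖ - ‖b‖)]

/-! ### Nodal maxima against local $L^2$ norms. -/

section Mass

variable {u w : E3 → E3}

lemma IsP1.integrableOn_inner (hu : 𝒯.IsP1 u) (hw : 𝒯.IsP1 w) (hK : K ∈ 𝒯.cells) :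
    IntegrableOn (fun x => inner ℝ (u x) (w x)) (openCell K) := by
  obtain ⟨A, hA, hA'⟩ := hu.exists_affine_openCell hK
  obtain ⟨B, hB, hB'⟩ := hw.exists_affine_openCell hK
  exact integrableOn_openCell_of_eqOn (hA.inner hB) fun x hx => by
    simp only [hA' hx, hB' hx]

lemma nonempty_cell (hK : K ∈ 𝒯.cells) : K.Nonempty := by
  rw [← Finset.card_pos, 𝒯.card_eq_four K hK]
  norm_num

/-- On each cell, the square of the largest nodal value is controlled by the mean of the square. -/
lemma IsP1.exists_max_vertex (hu : 𝒯.IsP1 u) (hK : K ∈ 𝒯.cells) :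
    ∃ z₀ ∈ K, (∀ z ∈ K, ‖u z‖ ≤ ‖u z₀‖) ∧
      volume.real (openCell K) * ‖u z₀‖ ^ 2 ≤ 256 * ∫ x in openCell K, inner ℝ (u x) (u x) := by
  obtain ⟨z₀, hz₀, hmax⟩ := K.exists_max_image (fun z => ‖u z‖) (nonempty_cell hK)
  refine ⟨z₀, hz₀, hmax, ?_⟩
  obtain ⟨A, hA⟩ := hu.2 K hK
  set T := convexHull ℝ (K : Set E3) with hT
  -- Shrink the cell by $1/4$ towards the maximal vertex: there $|u|\ge(\frac34-\frac14)|u(z_0)|$,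
  -- and the volume is $1/64$ of the cell's. Hence $256=4\cdot64$.
  set H := AffineMap.homothety z₀ (1 / 4 : ℝ) with hH
  have hconv : Convex ℝ T := convex_convexHull ℝ _
  have hHx : ∀ x, H x = (1 / 4 : ℝ) • x + (3 / 4 : ℝ) • z₀ := fun x => by
    rw [hH, AffineMap.homothety_eq_lineMap, AffineMap.lineMap_apply_module, add_comm]
    norm_num
  have hsub : H '' T ⊆ T := by
    rintro _ ⟨x, hx, rfl⟩
    rw [hHx]
    exact hconv hx (mem_cell hz₀) (by norm_num) (by norm_num) (by norm_num)
  have hlow : ∀ y ∈ H '' T, ‖u z₀‖ ^ 2 / 4 ≤ inner ℝ (u y) (u y) := by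
    rintro y ⟨x, hx, rfl⟩
    have h1 : u (H x) = (1 / 4 : ℝ) • u x + (3 / 4 : ℝ) • u z₀ := by
      rw [hA (hsub ⟨x, hx, rfl⟩), hA hx, hA (mem_cell hz₀), hH, AffineMap.homothety_eq_lineMap,
        AffineMap.apply_lineMap, AffineMap.lineMap_apply_module, add_comm]
      norm_num
    have h2 : ‖u x‖ ≤ ‖u z₀‖ := hu.norm_le hK hx hmax
    have h3 : ‖u z₀‖ / 2 ≤ ‖u (H x)‖ := by
      have h4 : (3 / 4 : ℝ) • u z₀ = u (H x) - (1 / 4 : ℝ) • u x := by rw [h1]; abel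
      have h5 := norm_sub_le (u (H x)) ((1 / 4 : ℝ) • u x)
      rw [← h4, norm_smul, norm_smul] at h5
      norm_num at h5
      linarith
    rw [real_inner_self_eq_norm_sq]
    nlinarith [norm_nonneg (u z₀)]
  have hint : IntegrableOn (fun x => inner ℝ (u x) (u x)) T := by
    rw [← integrableOn_congr_set_ae (openCell_ae_eq K)]
    exact hu.integrableOn_inner hu hK
  have hHc : IsCompact (H '' T) :=
    (isCompact_cell K).image H.continuous_of_finiteDimensional
  have hvol : volume.real (H '' T) = volume.real (openCell K) / 64 := by
    rw [measureReal_congr (openCell_ae_eq K), measureReal_def, hH,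
      Measure.addHaar_image_homothety, ENNReal.toReal_mul, ENNReal.toReal_ofReal (abs_nonneg _),
      measureReal_def, finrank_euclideanSpace, Fintype.card_fin]
    rw [abs_of_pos (by positivity)]
    ring
  rw [setIntegral_congr_set (openCell_ae_eq K)]
  have h1 : ∫ x in H '' T, inner ℝ (u x) (u x) ≤ ∫ x in T, inner ℝ (u x) (u x) :=
    setIntegral_mono_set hint (Filter.Eventually.of_forall fun x => real_inner_self_nonneg)
      hsub.eventuallyLE
  have h2 : ∫ _ in H '' T, ‖u z₀‖ ^ 2 / 4 ≤ ∫ x in H '' T, inner ℝ (u x) (u x) :=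
    setIntegral_mono_on (integrableOn_const hHc.measure_lt_top.ne) (hint.mono_set hsub)
      hHc.measurableSet hlow
  rw [setIntegral_const, hvol, smul_eq_mul] at h2
  linarith

end Mass

end TetMesh

lemma norm_curl_sq_le (u : E3 → E3) (x : E3) : ‖curl u x‖ ^ 2 ≤ 2 * gradDot u u x := by
  have hg : gradDot u u x = ∑ i : Fin 3, ∑ j : Fin 3, pd i u x j ^ 2 := by
    simp only [gradDot, real_inner_self_eq_norm_sq, EuclideanSpace.real_norm_sq_eq]
  rw [hg, EuclideanSpace.real_norm_sq_eq]
  simp only [curl, Fin.sum_univ_three, Fin.isValue, PiLp.toLp_apply, Matrix.cons_val_zero,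
    Matrix.cons_val_one, Matrix.cons_val]
  nlinarith [sq_nonneg (pd 1 u x 2 + pd 2 u x 1), sq_nonneg (pd 2 u x 0 + pd 0 u x 2),
    sq_nonneg (pd 0 u x 1 + pd 1 u x 0), sq_nonneg (pd 0 u x 0), sq_nonneg (pd 1 u x 1),
    sq_nonneg (pd 2 u x 2)]

lemma inner_cross_right (a b : E3) : inner ℝ (cross a b) b = 0 := by
  simp [cross, crossProduct, PiLp.inner_apply, Fin.sum_univ_three]
  ring

lemma gradDot_self_nonneg {F : Type*} [NormedAddCommGroup F] [InnerProductSpace ℝ F]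
    (u : E3 → F) (x : E3) : 0 ≤ gradDot u u x :=
  Finset.sum_nonneg fun _ _ => real_inner_self_nonneg

lemma gradL2_self_nonneg {F : Type*} [NormedAddCommGroup F] [InnerProductSpace ℝ F]
    (Ω : Set E3) (u : E3 → F) : 0 ≤ gradL2 Ω u u :=
  integral_nonneg fun x => gradDot_self_nonneg u x

lemma l2_self_nonneg (Ω : Set E3) (u : E3 → E3) : 0 ≤ l2 Ω u u :=
  integral_nonneg fun _ => real_inner_self_nonneg

lemma l2_comm (Ω : Set E3) (u w : E3 → E3) : l2 Ω u w = l2 Ω w u := by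
  simp only [l2, real_inner_comm]

/-! ### Curl bounds and the quadratic expansion of the energy. -/

namespace TetMesh

variable {𝒯 : TetMesh} {K : Finset E3} {Ω : Set E3} {u w : E3 → E3}

lemma IsP1.pd_add_smul (hu : 𝒯.IsP1 u) (hw : 𝒯.IsP1 w) (c : ℝ) (hK : K ∈ 𝒯.cells) {x : E3}
    (hx : x ∈ openCell K) (i : Fin 3) :
    pd i (fun y => u y + c • w y) x = pd i u x + c • pd i w x := by
  rw [(hu.add (hw.smul c)).pd_eq hK hx, hu.pd_eq hK hx, hw.pd_eq hK hx, Finset.smul_sum,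
    ← Finset.sum_add_distrib]
  exact Finset.sum_congr rfl fun z _ => by rw [smul_add, smul_comm]

lemma IsP1.curl_add_smul (hu : 𝒯.IsP1 u) (hw : 𝒯.IsP1 w) (c : ℝ) (hK : K ∈ 𝒯.cells) {x : E3}
    (hx : x ∈ openCell K) :
    curl (fun y => u y + c • w y) x = curl u x + c • curl w x := by
  ext j
  fin_cases j <;> simp [curl, hu.pd_add_smul hw c hK hx] <;> ring

lemma IsP1.curl_eqOn (hu : 𝒯.IsP1 u) (hK : K ∈ 𝒯.cells) :
    ∃ c : E3, Set.EqOn (curl u) (fun _ => c) (openCell K) := by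
  rcases (openCell K).eq_empty_or_nonempty with h0 | ⟨x₀, hx₀⟩
  · exact ⟨0, by simp [h0]⟩
  · refine ⟨curl u x₀, fun x hx => ?_⟩
    simp only [curl, hu.pd_eq hK hx, hu.pd_eq hK hx₀]

lemma IsP1.norm_curl_le {κ h : ℝ} (hκ : 1 ≤ κ) (hh : 0 < h) (hq : 𝒯.QuasiUniform κ h)
    (hu : 𝒯.IsP1 u) (hK : K ∈ 𝒯.cells) {x : E3} (hx : x ∈ openCell K) {B : ℝ}
    (hB : ∀ z ∈ K, ‖u z‖ ≤ B) : ‖curl u x‖ ≤ 10 * (κ ^ 2 / h) * B := by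
  obtain ⟨z, hz⟩ := nonempty_cell hK
  have hB0 : 0 ≤ B := (norm_nonneg _).trans (hB z hz)
  refine le_of_sq_le_sq ((norm_curl_sq_le u x).trans ?_) (by positivity)
  have h1 : gradDot u u x ≤ ∑ _i : Fin 3, (4 * (κ ^ 2 / h) * B) ^ 2 := by
    refine Finset.sum_le_sum fun i _ => ?_
    rw [real_inner_self_eq_norm_sq]
    have := hu.norm_pd_le hκ hh hq hK hx i hB
    gcongr
  simp only [Finset.sum_const, Finset.card_univ, Fintype.card_fin, nsmul_eq_mul] at h1
  push_cast at h1
  -- $2\cdot3\cdot4^2=96\le10^2$.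
  nlinarith [sq_nonneg (κ ^ 2 / h * B)]

lemma IsP1.integrableOn_curl_inner_cell (hu : 𝒯.IsP1 u) (hw : 𝒯.IsP1 w) (hK : K ∈ 𝒯.cells) :
    IntegrableOn (fun x => inner ℝ (curl u x) (w x)) (openCell K) := by
  obtain ⟨c, hc⟩ := hu.curl_eqOn hK
  obtain ⟨B, hB, hB'⟩ := hw.exists_affine_openCell hK
  exact integrableOn_openCell_of_eqOn (g := fun x => inner ℝ c (B x)) (continuous_const.inner hB)
    fun x hx => by simp only [hc hx, hB' hx]

lemma IsP1.integrableOn_curl_inner (hΩ : 𝒯.IsMeshOf Ω) (hu : 𝒯.IsP1 u) (hw : 𝒯.IsP1 w) :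
    IntegrableOn (fun x => inner ℝ (curl u x) (w x)) Ω :=
  integrableOn_domain hΩ fun _ hK => hu.integrableOn_curl_inner_cell hw hK

lemma IsP1.integrableOn_inner_domain (hΩ : 𝒯.IsMeshOf Ω) (hu : 𝒯.IsP1 u) (hw : 𝒯.IsP1 w) :
    IntegrableOn (fun x => inner ℝ (u x) (w x)) Ω :=
  integrableOn_domain hΩ fun _ hK => hu.integrableOn_inner hw hK

lemma IsP1.integrableOn_gradDot_domain (hΩ : 𝒯.IsMeshOf Ω) (hu : 𝒯.IsP1 u) (hw : 𝒯.IsP1 w) :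
    IntegrableOn (gradDot u w) Ω :=
  integrableOn_domain hΩ fun _ hK => hu.integrableOn_gradDot hw hK

lemma IsP1.gradL2_add_smul (hΩ : 𝒯.IsMeshOf Ω) (hu : 𝒯.IsP1 u) (hw : 𝒯.IsP1 w) (c : ℝ) :
    gradL2 Ω (fun x => u x + c • w x) (fun x => u x + c • w x) =
      gradL2 Ω u u + 2 * c * gradL2 Ω u w + c ^ 2 * gradL2 Ω w w := by
  have h1 := hu.integrableOn_gradDot_domain hΩ hu
  have h2 := (hu.integrableOn_gradDot_domain hΩ hw).const_mul (2 * c)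
  have h3 := (hw.integrableOn_gradDot_domain hΩ hw).const_mul (c ^ 2)
  have h12 : IntegrableOn (fun x => gradDot u u x + 2 * c * gradDot u w x) Ω := h1.add h2
  simp only [gradL2]
  rw [← integral_const_mul, ← integral_const_mul, ← integral_add h1 h2,
    ← integral_add h12 h3]
  refine integral_congr_ae ?_
  filter_upwards [ae_mem_openCell hΩ] with x ⟨K, hK, hx⟩
  simp only [gradDot, hu.pd_add_smul hw c hK hx, Finset.mul_sum, ← Finset.sum_add_distrib]
  refine Finset.sum_congr rfl fun i _ => ?_
  rw [real_inner_add_add_self, real_inner_smul_right, real_inner_smul_right, real_inner_smul_left]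
  ring

lemma IsP1.l2_curl_add_smul (hΩ : 𝒯.IsMeshOf Ω) (hu : 𝒯.IsP1 u) (hw : 𝒯.IsP1 w) (c : ℝ) :
    l2 Ω (curl fun x => u x + c • w x) (fun x => u x + c • w x) =
      l2 Ω (curl u) u + c * l2 Ω (curl u) w + c * l2 Ω (curl w) u + c ^ 2 * l2 Ω (curl w) w := by
  have h1 := hu.integrableOn_curl_inner hΩ hu
  have h2 := (hu.integrableOn_curl_inner hΩ hw).const_mul c
  have h3 := (hw.integrableOn_curl_inner hΩ hu).const_mul c
  have h4 := (hw.integrableOn_curl_inner hΩ hw).const_mul (c ^ 2)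
  have h12 : IntegrableOn (fun x => inner ℝ (curl u x) (u x) + c * inner ℝ (curl u x) (w x)) Ω :=
    h1.add h2
  have h123 : IntegrableOn (fun x => inner ℝ (curl u x) (u x) + c * inner ℝ (curl u x) (w x)
      + c * inner ℝ (curl w x) (u x)) Ω := h12.add h3
  simp only [l2]
  rw [← integral_const_mul, ← integral_const_mul, ← integral_const_mul, ← integral_add h1 h2,
    ← integral_add h12 h3, ← integral_add h123 h4]
  refine integral_congr_ae ?_
  filter_upwards [ae_mem_openCell hΩ] with x ⟨K, hK, hx⟩
  rw [hu.curl_add_smul hw c hK hx]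
  simp only [inner_add_left, inner_add_right, real_inner_smul_right, real_inner_smul_left]
  ring

lemma IsP1.energy_add_smul (hΩ : 𝒯.IsMeshOf Ω) (lex ldm : ℝ) (hu : 𝒯.IsP1 u) (hw : 𝒯.IsP1 w)
    (c : ℝ) : energy Ω lex ldm (fun x => u x + c • w x) = energy Ω lex ldm u
      + c * (lex ^ 2 * gradL2 Ω u w + ldm / 2 * l2 Ω (curl u) w + ldm / 2 * l2 Ω (curl w) u)
      + c ^ 2 * energy Ω lex ldm w := by
  rw [energy, hu.gradL2_add_smul hΩ hw, hu.l2_curl_add_smul hΩ hw, energy, energy]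
  ring

/-! ### Effect of the nodal projection, and one step of the scheme. -/

lemma norm_add_smul_sq {a b : E3} (ha : ‖a‖ = 1) (hab : inner ℝ a b = 0) (k : ℝ) :
    ‖a + k • b‖ ^ 2 = 1 + k ^ 2 * ‖b‖ ^ 2 := by
  rw [norm_add_sq_real, ha, real_inner_smul_right, hab, norm_smul, mul_pow, Real.norm_eq_abs,
    sq_abs]
  ring

lemma one_le_norm_add_smul {a b : E3} (ha : ‖a‖ = 1) (hab : inner ℝ a b = 0) (k : ℝ) :
    1 ≤ ‖a + k • b‖ := by
  have := norm_add_smul_sq ha hab k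
  refine le_of_sq_le_sq ?_ (norm_nonneg _)
  nlinarith [mul_nonneg (sq_nonneg k) (sq_nonneg ‖b‖)]

lemma norm_normalize_sub {a : E3} (ha : 1 ≤ ‖a‖) : ‖‖a‖⁻¹ • a - a‖ = ‖a‖ - 1 := by
  have ha0 : 0 < ‖a‖ := by linarith
  have h1 : ‖a‖⁻¹ • a - a = (‖a‖⁻¹ - 1) • a := by rw [sub_smul, one_smul]
  have h2 : ‖a‖⁻¹ ≤ 1 := inv_le_one_of_one_le₀ ha
  rw [h1, norm_smul, Real.norm_of_nonpos (by linarith)]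
  field_simp
  ring

/-- With $d=m'-w$, the difference of the curl energies is
$(\operatorname{curl}m',d)+(\operatorname{curl}d,m')-(\operatorname{curl}d,d)$. The first two terms
use the quadratic bound on $d$ together with $|m'|\le1$, the last uses the linear bound twice. Each
integrand is at most $10\kappa^2h^{-1}k^2V^2$, with $V$ the largest nodal value of $|v|$ on the
cell, and $7680=3\cdot10\cdot256$. No integration by parts occurs, so no boundary terms arise. -/
lemma IsP1.curl_projection_le {κ h k : ℝ} (hκ : 1 ≤ κ) (hh : 0 < h) (hk : 0 < k)
    (hq : 𝒯.QuasiUniform κ h) (hΩ : 𝒯.IsMeshOf Ω) {m m' v : E3 → E3}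
    (hm : m ∈ 𝒯.Magnetization) (hm' : m' ∈ 𝒯.Magnetization) (hv : v ∈ 𝒯.Tangent m)
    (hup : ∀ z ∈ 𝒯.nodes, m' z = ‖m z + k • v z‖⁻¹ • (m z + k • v z)) :
    l2 Ω (curl m') m' ≤ l2 Ω (curl fun x => m x + k • v x) (fun x => m x + k • v x)
      + 7680 * κ ^ 2 * h⁻¹ * k ^ 2 * l2 Ω v v := by
  set w : E3 → E3 := fun x => m x + k • v x with hw
  have hwP : 𝒯.IsP1 w := hm.1.add (hv.1.smul k)
  set d : E3 → E3 := fun x => m' x + (-1 : ℝ) • w x with hd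
  have hdP : 𝒯.IsP1 d := hm'.1.add (hwP.smul (-1))
  have hdz : ∀ z ∈ 𝒯.nodes, ‖d z‖ ≤ k ^ 2 * ‖v z‖ ^ 2 ∧ ‖d z‖ ≤ k * ‖v z‖ := by
    intro z hz
    have h1 : 1 ≤ ‖w z‖ := one_le_norm_add_smul (hm.2 z hz) (hv.2 z hz) k
    have h2 : ‖w z‖ ^ 2 = 1 + k ^ 2 * ‖v z‖ ^ 2 := norm_add_smul_sq (hm.2 z hz) (hv.2 z hz) k
    have h3 : ‖d z‖ = ‖w z‖ - 1 := by
      rw [← norm_normalize_sub h1, hd]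
      simp only [hup z hz, neg_smul, one_smul, ← sub_eq_add_neg]
      rfl
    rw [h3]
    -- Since $|w|\ge1$, both $|w|-1$ and $(|w|-1)^2$ are at most $|w|^2-1=k^2|v|^2$.
    refine ⟨by nlinarith, le_of_sq_le_sq (by nlinarith) (by positivity)⟩
  have hcell : ∀ K ∈ 𝒯.cells, ∫ x in openCell K, inner ℝ (curl m' x) (m' x) ≤
      (∫ x in openCell K, inner ℝ (curl w x) (w x))
        + 7680 * κ ^ 2 * h⁻¹ * k ^ 2 * ∫ x in openCell K, inner ℝ (v x) (v x) := by
    intro K hK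
    obtain ⟨z₀, hz₀, hmax, hmass⟩ := hv.1.exists_max_vertex hK
    have hnode : ∀ z ∈ K, z ∈ 𝒯.nodes := fun z hz => ⟨K, hK, hz⟩
    set V := ‖v z₀‖ with hV
    have hV0 : 0 ≤ V := norm_nonneg _
    have hd1 : ∀ z ∈ K, ‖d z‖ ≤ k ^ 2 * V ^ 2 := fun z hz =>
      (hdz z (hnode z hz)).1.trans (by have := hmax z hz; gcongr)
    have hd2 : ∀ z ∈ K, ‖d z‖ ≤ k * V := fun z hz =>
      (hdz z (hnode z hz)).2.trans (by have := hmax z hz; gcongr)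
    have hone : ∀ z ∈ K, ‖m' z‖ ≤ 1 := fun z hz => (hm'.2 z (hnode z hz)).le
    have hpt : ∀ x ∈ openCell K, inner ℝ (curl m' x) (m' x) ≤
        inner ℝ (curl w x) (w x) + 30 * (κ ^ 2 / h) * (k ^ 2 * V ^ 2) := by
      intro x hx
      have hx' := openCell_subset K hx
      have c1 := hm'.1.norm_curl_le hκ hh hq hK hx hone
      have c2 := hdP.norm_curl_le hκ hh hq hK hx hd1
      have c3 := hdP.norm_curl_le hκ hh hq hK hx hd2
      have b1 := hm'.1.norm_le hK hx' hone
      have b2 := hdP.norm_le hK hx' hd1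
      have b3 := hdP.norm_le hK hx' hd2
      have hcd : curl d x = curl m' x - curl w x := by
        rw [hd, hm'.1.curl_add_smul hwP (-1) hK hx, neg_smul, one_smul, sub_eq_add_neg]
      have hdx : d x = m' x - w x := by simp [hd, sub_eq_add_neg]
      have key : inner ℝ (curl m' x) (m' x) - inner ℝ (curl w x) (w x) =
          inner ℝ (curl m' x) (d x) + inner ℝ (curl d x) (m' x) - inner ℝ (curl d x) (d x) := by
        rw [hcd, hdx]
        simp only [inner_sub_left, inner_sub_right]
        ring
      have e1 : inner ℝ (curl m' x) (d x) ≤ 10 * (κ ^ 2 / h) * 1 * (k ^ 2 * V ^ 2) :=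
        (real_inner_le_norm _ _).trans (by gcongr)
      have e2 : inner ℝ (curl d x) (m' x) ≤ 10 * (κ ^ 2 / h) * (k ^ 2 * V ^ 2) * 1 :=
        (real_inner_le_norm _ _).trans (by gcongr)
      have e3 : -inner ℝ (curl d x) (d x) ≤ 10 * (κ ^ 2 / h) * (k * V) * (k * V) :=
        (neg_le_abs _).trans ((abs_real_inner_le_norm _ _).trans (by gcongr))
      linarith
    have hconst : IntegrableOn (fun _ : E3 => 30 * (κ ^ 2 / h) * (k ^ 2 * V ^ 2)) (openCell K) :=
      integrableOn_const (volume_openCell_lt_top K).ne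
    have hI := setIntegral_mono_on (hm'.1.integrableOn_curl_inner_cell hm'.1 hK)
      ((hwP.integrableOn_curl_inner_cell hwP hK).add hconst) (measurableSet_openCell K) hpt
    simp only [Pi.add_apply] at hI
    rw [integral_add (hwP.integrableOn_curl_inner_cell hwP hK) hconst, setIntegral_const,
      smul_eq_mul] at hI
    refine hI.trans ?_
    have hp : 0 ≤ 30 * (κ ^ 2 / h) * k ^ 2 := by positivity
    have := mul_le_mul_of_nonneg_left hmass hp
    have e4 : 30 * (κ ^ 2 / h) * k ^ 2 * (256 * ∫ x in openCell K, inner ℝ (v x) (v x)) =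
        7680 * κ ^ 2 * h⁻¹ * k ^ 2 * ∫ x in openCell K, inner ℝ (v x) (v x) := by ring
    rw [e4] at this
    linarith
  simp only [l2]
  rw [setIntegral_domain hΩ fun K hK => hm'.1.integrableOn_curl_inner_cell hm'.1 hK,
    setIntegral_domain hΩ fun K hK => hwP.integrableOn_curl_inner_cell hwP hK,
    setIntegral_domain hΩ fun K hK => hv.1.integrableOn_inner hv.1 hK, Finset.mul_sum,
    ← Finset.sum_add_distrib]
  exact Finset.sum_le_sum hcell

/-- The energy decay in one step of the scheme. -/
lemma energy_step {κ h k α lex ldm : ℝ} (hκ : 1 ≤ κ) (hh : 0 < h) (hk : 0 < k) (hldm : 0 < ldm)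
    (hq : 𝒯.QuasiUniform κ h) (hΩ : 𝒯.IsMeshOf Ω) (hA : AngleCondition 𝒯 Ω) {m m' v : E3 → E3}
    (hm : m ∈ 𝒯.Magnetization) (hm' : m' ∈ 𝒯.Magnetization) (hv : v ∈ 𝒯.Tangent m)
    (hstep : StepEquation 𝒯 Ω α lex ldm k m v)
    (hup : ∀ z ∈ 𝒯.nodes, m' z = ‖m z + k • v z‖⁻¹ • (m z + k • v z)) :
    energy Ω lex ldm m' + k * l2 Ω (weighted α lex ldm k m v) v
        + lex ^ 2 / 2 * rho k * k ^ 2 * gradL2 Ω v v ≤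
      energy Ω lex ldm m + 3840 * κ ^ 2 * ldm * h⁻¹ * k ^ 2 * l2 Ω v v := by
  have hgrad : gradL2 Ω m' m' ≤ gradL2 Ω (fun x => m x + k • v x) (fun x => m x + k • v x) := by
    refine hm'.1.gradL2_le_of_contraction hΩ hA (hm.1.add (hv.1.smul k)) fun z hz z' hz' => ?_
    rw [hup z hz, hup z' hz']
    exact norm_inv_smul_sub_le (one_le_norm_add_smul (hm.2 z hz) (hv.2 z hz) k)
      (one_le_norm_add_smul (hm.2 z' hz') (hv.2 z' hz') k)
  have hcurl := IsP1.curl_projection_le hκ hh hk hq hΩ hm hm' hv hup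
  have hexp := hm.1.energy_add_smul hΩ lex ldm hv.1 k
  have heq := hstep v hv
  have hcross : l2 Ω (fun x => cross (m x) (v x)) v = 0 := by
    simp [l2, inner_cross_right]
  rw [hcross, l2_comm Ω v (curl v), l2_comm Ω m (curl v)] at heq
  have hle : energy Ω lex ldm m' ≤ energy Ω lex ldm (fun x => m x + k • v x)
      + 3840 * κ ^ 2 * ldm * h⁻¹ * k ^ 2 * l2 Ω v v := by
    have h1 := mul_le_mul_of_nonneg_left hgrad (by positivity : 0 ≤ lex ^ 2 / 2)
    have h2 := mul_le_mul_of_nonneg_left hcurl (by positivity : 0 ≤ ldm / 2)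
    simp only [energy]
    linarith
  -- Times $k$, the equation cancels the linear term and $k^2\mathcal E(v)$ in `hexp`; only the
  -- $\rho$ term and the dissipation survive.
  have hk2 := congrArg (fun t => k * t) heq
  rw [hexp, energy.eq_def Ω lex ldm v] at hle
  linarith

end TetMesh

/-! ### The cut-off weight. -/

lemma measurable_cutoff (α k M : ℝ) : Measurable (cutoff α k M) := by
  unfold cutoff
  refine Measurable.ite measurableSet_Ici ?_ ?_ <;> fun_prop

lemma cutLevel_nonneg (k : ℝ) : 0 ≤ cutLevel k := inv_nonneg.2 (abs_nonneg _)

lemma cutoff_nonneg {α k M : ℝ} (hα : 0 < α) (hk : 0 < k) (hM : 0 ≤ M) (s : ℝ) :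
    0 ≤ cutoff α k M s := by
  unfold cutoff
  split_ifs with hs
  · have := le_min hs hM
    positivity
  · have : 0 ≤ min (-s) M := le_min (by linarith) hM
    positivity

lemma cutoff_le {α k M : ℝ} (hα : 0 < α) (hk : 0 < k) (hM : 0 ≤ M) (s : ℝ) :
    cutoff α k M s ≤ α + k * M / 2 := by
  unfold cutoff
  split_ifs with hs
  · have := min_le_right s M
    gcongr
  · have h1 : 0 ≤ min (-s) M := le_min (by linarith) hM
    have h2 : 0 ≤ k * M / 2 := by positivity
    have h3 : 2 * α ^ 2 / (2 * α + k * min (-s) M) ≤ α := by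
      rw [div_le_iff₀ (by positivity)]
      nlinarith [mul_nonneg hα.le (mul_nonneg hk.le h1)]
    linarith

/-- For negative `s` the denominator is at most $4\alpha$, whence $2\alpha^2/(4\alpha)=\alpha/2$. -/
lemma half_le_cutoff {α k M : ℝ} (hα : 0 < α) (hk : 0 < k) (hM : 0 ≤ M) (hkM : k * M ≤ 2 * α)
    (s : ℝ) : α / 2 ≤ cutoff α k M s := by
  unfold cutoff
  split_ifs with hs
  · have h1 : 0 ≤ k * min s M := mul_nonneg hk.le (le_min hs hM)
    linarith
  · have h1 : 0 ≤ min (-s) M := le_min (by linarith) hM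
    have h2 : k * min (-s) M ≤ k * M := mul_le_mul_of_nonneg_left (min_le_right _ _) hk.le
    rw [le_div_iff₀ (by positivity)]
    nlinarith

/-- The product is $|\log k|^{-1}$, and the threshold on `k` is exactly $|\log k|\ge1/(2\alpha)$. -/
lemma mul_cutLevel_le {α k : ℝ} (hα : 0 < α) (hk : 0 < k)
    (hk₀ : k ≤ Real.exp (-(2 * α)⁻¹)) : k * cutLevel k ≤ 2 * α := by
  have h1 : Real.log k ≤ -(2 * α)⁻¹ := (Real.log_le_iff_le_exp hk).2 hk₀
  have h2 : (2 * α)⁻¹ ≤ |Real.log k| := by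
    linarith [neg_le_abs (Real.log k)]
  have h3 : k * cutLevel k = |Real.log k|⁻¹ := by
    rw [cutLevel, abs_mul, abs_of_pos hk, mul_inv, ← mul_assoc, mul_inv_cancel₀ hk.ne', one_mul]
  rw [h3]
  exact inv_le_of_inv_le₀ (by positivity) h2

namespace TetMesh

variable {𝒯 : TetMesh} {K : Finset E3} {Ω : Set E3} {m v : E3 → E3}

lemma IsP1.integrableOn_weighted {α lex ldm k : ℝ} (hα : 0 < α) (hk : 0 < k)
    (hm : 𝒯.IsP1 m) (hv : 𝒯.IsP1 v) (hK : K ∈ 𝒯.cells) :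
    IntegrableOn (fun x => inner ℝ (weighted α lex ldm k m v x) (v x)) (openCell K) := by
  obtain ⟨c, hc⟩ := hm.curl_eqOn hK
  obtain ⟨A, hA, hA'⟩ := hm.exists_affine_openCell hK
  have hg := hm.gradDot_eqOn hm hK
  set g := ∑ i : Fin 3,
      inner ℝ (∑ z ∈ K, 𝒯.slope K z i • m z) (∑ z ∈ K, 𝒯.slope K z i • m z)
  have hmeas : Measurable fun x => cutoff α k (cutLevel k)
      (-lex ^ 2 * g - ldm * inner ℝ c (A x)) :=
    (measurable_cutoff _ _ _).comp (by fun_prop)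
  have hbd : ∀ᵐ x ∂volume.restrict (openCell K), ‖cutoff α k (cutLevel k)
      (-lex ^ 2 * g - ldm * inner ℝ c (A x))‖ ≤ α + k * cutLevel k / 2 :=
    Filter.Eventually.of_forall fun x => by
      rw [Real.norm_of_nonneg (cutoff_nonneg hα hk (cutLevel_nonneg k) _)]
      exact cutoff_le hα hk (cutLevel_nonneg k) _
  have hI := Integrable.bdd_mul (hv.integrableOn_inner hv hK) hmeas.aestronglyMeasurable hbd
  refine (integrableOn_congr_fun (fun x hx => ?_) (measurableSet_openCell K)).2 hI
  simp only [weighted, multiplier, hg hx, hc hx, hA' hx, real_inner_smul_left]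

lemma IsP1.half_l2_le_weighted {α lex ldm k : ℝ} (hα : 0 < α) (hk : 0 < k)
    (hk₀ : k ≤ Real.exp (-(2 * α)⁻¹)) (hΩ : 𝒯.IsMeshOf Ω) (hm : 𝒯.IsP1 m) (hv : 𝒯.IsP1 v) :
    α / 2 * l2 Ω v v ≤ l2 Ω (weighted α lex ldm k m v) v := by
  rw [l2, l2, ← integral_const_mul]
  refine integral_mono ((hv.integrableOn_inner_domain hΩ hv).const_mul _)
    (integrableOn_domain hΩ fun K hK => hm.integrableOn_weighted hα hk hv hK) fun x => ?_
  simp only [weighted, real_inner_smul_left]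
  exact mul_le_mul_of_nonneg_right
    (half_le_cutoff hα hk (cutLevel_nonneg k) (mul_cutLevel_le hα hk hk₀) _)
    real_inner_self_nonneg

/-! ### Lower-order bounds and coercivity of the energy. -/

lemma l2_self_le_volume (hΩ : 𝒯.IsMeshOf Ω) (hm : m ∈ 𝒯.Magnetization) :
    l2 Ω m m ≤ volume.real Ω := by
  have h1 : l2 Ω m m ≤ ∫ _ in Ω, (1 : ℝ) := by
    refine integral_mono_ae (hm.1.integrableOn_inner_domain hΩ hm.1)
      (integrableOn_const (volume_domain_lt_top hΩ).ne) ?_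
    filter_upwards [ae_mem_openCell hΩ] with x ⟨K, hK, hx⟩
    rw [real_inner_self_eq_norm_sq]
    have := hm.1.norm_le hK (openCell_subset K hx) fun z hz => (hm.2 z ⟨K, hK, hz⟩).le
    exact pow_le_one₀ (norm_nonneg _) this
  simpa using h1

/-- Pointwise Young inequality with weight `ε`, then $|\operatorname{curl}m|^2\le2|\nabla m|^2$. -/
lemma IsP1.abs_l2_curl_le (hΩ : 𝒯.IsMeshOf Ω) (hm : 𝒯.IsP1 m) {ε : ℝ} (hε : 0 < ε) :
    |l2 Ω (curl m) m| ≤ ε * gradL2 Ω m m + (2 * ε)⁻¹ * l2 Ω m m := by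
  have h2 := (hm.integrableOn_gradDot_domain hΩ hm).const_mul ε
  have h3 := (hm.integrableOn_inner_domain hΩ hm).const_mul (2 * ε)⁻¹
  rw [l2, l2, gradL2, ← integral_const_mul, ← integral_const_mul, ← integral_add h2 h3]
  refine (abs_integral_le_integral_abs).trans (integral_mono
    (hm.integrableOn_curl_inner hΩ hm).abs (h2.add h3) fun x => ?_)
  refine (abs_real_inner_le_norm _ _).trans ?_
  have hc := norm_curl_sq_le m x
  simp only [real_inner_self_eq_norm_sq]
  have h4 : 0 ≤ (2 * ε)⁻¹ * (ε * ‖curl m x‖ - ‖m x‖) ^ 2 := by positivity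
  have h5 : (2 * ε)⁻¹ * (ε * ‖curl m x‖ - ‖m x‖) ^ 2 =
      ε * (‖curl m x‖ ^ 2 / 2) - ‖curl m x‖ * ‖m x‖ + (2 * ε)⁻¹ * ‖m x‖ ^ 2 := by
    field_simp
    ring
  have h6 : ε * (‖curl m x‖ ^ 2 / 2) ≤ ε * gradDot m m x :=
    mul_le_mul_of_nonneg_left (by linarith) hε.le
  linarith

lemma IsP1.abs_dmi_le {lex ldm : ℝ} (hlex : 0 < lex) (hldm : 0 < ldm) (hΩ : 𝒯.IsMeshOf Ω)
    (hm : 𝒯.IsP1 m) : |ldm / 2 * l2 Ω (curl m) m| ≤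
      lex ^ 2 / 4 * gradL2 Ω m m + ldm ^ 2 / (2 * lex ^ 2) * l2 Ω m m := by
  -- This `ε` makes the curl energy cost exactly half of the exchange energy.
  have h1 := hm.abs_l2_curl_le hΩ (ε := lex ^ 2 / (2 * ldm)) (by positivity)
  rw [abs_mul, abs_of_pos (by positivity : 0 < ldm / 2)]
  refine (mul_le_mul_of_nonneg_left h1 (by positivity)).trans_eq ?_
  field_simp
  ring

end TetMesh

lemma h1Norm_sq (Ω : Set E3) (u : E3 → E3) : h1Norm Ω u ^ 2 = l2 Ω u u + gradL2 Ω u u :=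
  Real.sq_sqrt (add_nonneg (l2_self_nonneg Ω u) (gradL2_self_nonneg Ω u))

/-! ### Energy law and stability. -/

namespace IsTPS2

variable {𝒯 : TetMesh} {Ω : Set E3} {α κ h lex ldm k : ℝ} {N : ℕ} {m v : ℕ → E3 → E3}

lemma mem_magnetization (H : IsTPS2 𝒯 Ω α lex ldm k N m v) {i : ℕ} (hi : i ≤ N) :
    m i ∈ 𝒯.Magnetization := by
  cases i with
  | zero => exact H.initial
  | succ i => exact H.update_mem i hi

/-- The discrete energy law. -/
lemma energy_law (H : IsTPS2 𝒯 Ω α lex ldm k N m v) (hκ : 1 ≤ κ) (hh : 0 < h) (hk : 0 < k)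
    (hldm : 0 < ldm) (hq : 𝒯.QuasiUniform κ h) (hΩ : 𝒯.IsMeshOf Ω) (hA : AngleCondition 𝒯 Ω)
    {j : ℕ} (hj : j ≤ N) :
    energy Ω lex ldm (m j)
        + k * ∑ i ∈ Finset.range j, l2 Ω (weighted α lex ldm k (m i) (v i)) (v i)
        + lex ^ 2 / 2 * rho k * k ^ 2 * ∑ i ∈ Finset.range j, gradL2 Ω (v i) (v i)
      ≤ energy Ω lex ldm (m 0)
        + 3840 * κ ^ 2 * ldm * h⁻¹ * k ^ 2 * ∑ i ∈ Finset.range j, l2 Ω (v i) (v i) := by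
  induction j with
  | zero => simp
  | succ j ih =>
    have h1 := ih (by omega)
    have h2 := TetMesh.energy_step hκ hh hk hldm hq hΩ hA (H.mem_magnetization (by omega : j ≤ N))
      (H.update_mem j hj) (H.tangent j hj) (H.step j hj) (H.update j hj)
    simp only [Finset.sum_range_succ, mul_add]
    linarith

/-- The stability estimate. -/
lemma stability (H : IsTPS2 𝒯 Ω α lex ldm k N m v) (hκ : 1 ≤ κ) (hα : 0 < α) (hlex : 0 < lex)
    (hldm : 0 < ldm) (hh : 0 < h) (hk : 0 < k) (hq : 𝒯.QuasiUniform κ h) (hΩ : 𝒯.IsMeshOf Ω)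
    (hA : AngleCondition 𝒯 Ω) {j : ℕ} (hj : j ≤ N) {C₀ : ℝ} (hC₀ : h1Norm Ω (m 0) ≤ C₀)
    (hk₀ : k ≤ Real.exp (-(2 * α)⁻¹)) (hkh : k ≤ α / (4 * (3840 * κ ^ 2 * ldm)) * h) :
    h1Norm Ω (m j) ^ 2
        + k * ∑ i ∈ Finset.range j, l2 Ω (v i) (v i)
        + rho k * k ^ 2 * ∑ i ∈ Finset.range j, gradL2 Ω (v i) (v i)
      ≤ volume.real Ω + ((lex ^ 2 + ldm ^ 2 / lex ^ 2) * C₀ ^ 2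
          + ldm ^ 2 / (2 * lex ^ 2) * volume.real Ω) * (6 / lex ^ 2 + 4 / α) := by
  have hlaw := H.energy_law hκ hh hk hldm hq hΩ hA hj
  have hW : α / 2 * ∑ i ∈ Finset.range j, l2 Ω (v i) (v i) ≤
      ∑ i ∈ Finset.range j, l2 Ω (weighted α lex ldm k (m i) (v i)) (v i) := by
    rw [Finset.mul_sum]
    refine Finset.sum_le_sum fun i hi => ?_
    have hi' : i < N := (Finset.mem_range.1 hi).trans_le hj
    exact (H.mem_magnetization hi'.le).1.half_l2_le_weighted hα hk hk₀ hΩ (H.tangent i hi').1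
  have hS0 : 0 ≤ ∑ i ∈ Finset.range j, l2 Ω (v i) (v i) :=
    Finset.sum_nonneg fun i _ => l2_self_nonneg Ω _
  have hD0 : 0 ≤ ∑ i ∈ Finset.range j, gradL2 Ω (v i) (v i) :=
    Finset.sum_nonneg fun i _ => gradL2_self_nonneg Ω _
  set S := ∑ i ∈ Finset.range j, l2 Ω (v i) (v i)
  set D := ∑ i ∈ Finset.range j, gradL2 Ω (v i) (v i)
  set P := ∑ i ∈ Finset.range j, l2 Ω (weighted α lex ldm k (m i) (v i)) (v i)
  have hρ : 0 ≤ rho k * k ^ 2 * D := by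
    have : 0 ≤ rho k := abs_nonneg _
    positivity
  have hkS : 0 ≤ k * S := by positivity
  -- The condition $k\le C'h$ makes the error at most half of the dissipation $\frac\alpha2kS$.
  have hCk : 3840 * κ ^ 2 * ldm * h⁻¹ * k ^ 2 * S ≤ α / 4 * (k * S) := by
    have hκ0 : 0 < κ := by linarith
    have h1 : 3840 * κ ^ 2 * ldm * h⁻¹ * k ≤ α / 4 := by
      calc 3840 * κ ^ 2 * ldm * h⁻¹ * k
          ≤ 3840 * κ ^ 2 * ldm * h⁻¹ * (α / (4 * (3840 * κ ^ 2 * ldm)) * h) := by gcongr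
        _ = α / 4 := by field_simp
    calc _ = 3840 * κ ^ 2 * ldm * h⁻¹ * k * (k * S) := by ring
      _ ≤ _ := mul_le_mul_of_nonneg_right h1 hkS
  have hkW := mul_le_mul_of_nonneg_left hW hk.le
  have hmj := H.mem_magnetization hj
  have hLj := TetMesh.l2_self_le_volume hΩ hmj
  have hdj := (neg_le_abs _).trans (hmj.1.abs_dmi_le hlex hldm hΩ)
  have hd0 := (le_abs_self _).trans (H.initial.1.abs_dmi_le hlex hldm hΩ)
  have hG0 := gradL2_self_nonneg Ω (m 0)
  have hL0 := l2_self_nonneg Ω (m 0)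
  have hGj := gradL2_self_nonneg Ω (m j)
  have h0 : l2 Ω (m 0) (m 0) + gradL2 Ω (m 0) (m 0) ≤ C₀ ^ 2 := by
    rw [← h1Norm_sq]
    exact pow_le_pow_left₀ (Real.sqrt_nonneg _) hC₀ 2
  set R := (lex ^ 2 + ldm ^ 2 / lex ^ 2) * C₀ ^ 2 + ldm ^ 2 / (2 * lex ^ 2) * volume.real Ω with hR
  have hE0 : energy Ω lex ldm (m 0) ≤ (lex ^ 2 + ldm ^ 2 / lex ^ 2) * C₀ ^ 2 := by
    have hq : 0 ≤ ldm ^ 2 / lex ^ 2 := by positivity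
    have e1 : ldm ^ 2 / (2 * lex ^ 2) = ldm ^ 2 / lex ^ 2 / 2 := by field_simp
    have e2 := mul_le_mul_of_nonneg_left h0 (by positivity : 0 ≤ lex ^ 2 + ldm ^ 2 / lex ^ 2)
    rw [e1] at hd0
    have e3 := mul_nonneg hq hG0
    have e4 := mul_nonneg hq hL0
    have e5 := mul_nonneg (sq_nonneg lex) hG0
    have e6 := mul_nonneg (sq_nonneg lex) hL0
    rw [energy]
    linarith
  -- Half of the exchange energy and half of the guaranteed dissipation survive the absorptions;
  -- each nonnegative term is then bounded by `R` separately.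
  have hmain : lex ^ 2 / 4 * gradL2 Ω (m j) (m j) + α / 4 * (k * S)
      + lex ^ 2 / 2 * (rho k * k ^ 2 * D) ≤ R := by
    have e1 := mul_le_mul_of_nonneg_left hLj
      (by positivity : 0 ≤ ldm ^ 2 / (2 * lex ^ 2))
    rw [energy] at hlaw
    linarith
  have hl2 : 0 < lex ^ 2 := by positivity
  have t1 : 0 ≤ lex ^ 2 / 4 * gradL2 Ω (m j) (m j) := by positivity
  have t2 : 0 ≤ α / 4 * (k * S) := by positivity
  have t3 : 0 ≤ lex ^ 2 / 2 * (rho k * k ^ 2 * D) := by positivity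
  have s1 : gradL2 Ω (m j) (m j) ≤ R * (4 / lex ^ 2) := by
    rw [mul_div_assoc', le_div_iff₀ hl2]; linarith
  have s2 : k * S ≤ R * (4 / α) := by
    rw [mul_div_assoc', le_div_iff₀ hα]; linarith
  have s3 : rho k * k ^ 2 * D ≤ R * (2 / lex ^ 2) := by
    rw [mul_div_assoc', le_div_iff₀ hl2]; linarith
  have s4 : R * (6 / lex ^ 2 + 4 / α) = R * (4 / lex ^ 2) + R * (4 / α) + R * (2 / lex ^ 2) := by
    ring
  rw [h1Norm_sq, s4]
  linarith

end IsTPS2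

end Micromag

end

theorem proposition5p4 :
    ∃ (C : ℝ → ℝ → ℝ) (k₀ : ℝ → ℝ → ℝ → ℝ) (C' : ℝ → ℝ → ℝ → ℝ)
      (C'' : ℝ → ℝ → ℝ → ℝ → ℝ → ℝ → ℝ),
    ∀ κ α lex ldm : ℝ, 1 ≤ κ → 0 < α → 0 < lex → 0 < ldm →
      0 < C κ ldm ∧ 0 < k₀ α lex ldm ∧ 0 < C' α κ ldm ∧
      (∀ C₀ ω : ℝ, 0 < C₀ → 0 ≤ ω → 0 < C'' α C₀ κ lex ldm ω) ∧
      ∀ (Ω : Set E3) (𝒯 : TetMesh) (h k : ℝ) (N : ℕ) (m v : ℕ → E3 → E3),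
        𝒯.IsMeshOf Ω → 0 < h → 𝒯.QuasiUniform κ h → AngleCondition 𝒯 Ω →
        0 < k → k ≠ 1 → IsTPS2 𝒯 Ω α lex ldm k N m v →
        ∀ j : ℕ, 1 ≤ j → j ≤ N →
          (energy Ω lex ldm (m j)
              + k * ∑ i ∈ Finset.range j, l2 Ω (weighted α lex ldm k (m i) (v i)) (v i)
              + lex ^ 2 / 2 * rho k * k ^ 2 * ∑ i ∈ Finset.range j, gradL2 Ω (v i) (v i)
            ≤ energy Ω lex ldm (m 0)
              + C κ ldm * h⁻¹ * k ^ 2 * ∑ i ∈ Finset.range j, l2 Ω (v i) (v i)) ∧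
          (∀ C₀ : ℝ, 0 < C₀ → h1Norm Ω (m 0) ≤ C₀ →
            k ≤ k₀ α lex ldm → k ≤ C' α κ ldm * h →
            h1Norm Ω (m j) ^ 2
              + k * ∑ i ∈ Finset.range j, l2 Ω (v i) (v i)
              + rho k * k ^ 2 * ∑ i ∈ Finset.range j, gradL2 Ω (v i) (v i)
            ≤ C'' α C₀ κ lex ldm (MeasureTheory.volume.real Ω)) := by
  -- `C` is half of 7680, from the factor $\ell_{dm}/2$; `k₀` ensures $kM(k)\le2\alpha$; `C'`
  -- ensures $Ck/h\le\alpha/4$.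
  refine ⟨fun κ ldm => 3840 * κ ^ 2 * ldm, fun α _ _ => Real.exp (-(2 * α)⁻¹),
    fun α κ ldm => α / (4 * (3840 * κ ^ 2 * ldm)),
    fun α C₀ _ lex ldm ω => ω + ((lex ^ 2 + ldm ^ 2 / lex ^ 2) * C₀ ^ 2
      + ldm ^ 2 / (2 * lex ^ 2) * ω) * (6 / lex ^ 2 + 4 / α), ?_⟩
  intro κ α lex ldm hκ hα hlex hldm
  have hκ0 : 0 < κ := by linarith
  refine ⟨by positivity, by positivity, by positivity, fun C₀ ω hC₀ hω => by positivity, ?_⟩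
  intro Ω 𝒯 h k N m v hΩ hh hq hA hk _ H j _ hj
  exact ⟨H.energy_law hκ hh hk hldm hq hΩ hA hj, fun C₀ _ hC₀ hk₀ hkh =>
    H.stability hκ hα hlex hldm hh hk hq hΩ hA hj hC₀ hk₀ hkh⟩
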